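/- Let $G$ be a finite group and let $\mathscr{S}$ be any set of subgroups of $G$ closed under conjugation. Notation. $\Omega(G)=\mathbb{Q}\otimes_{\mathbb{Z}}\Omega_{\mathbb{Z}}(G)$ is the rational Burnside ring, where $\Omega_{\mathbb{Z}}(G)$ is the Grothendieck ring of finite $G$-sets, and $[X]\in\Omega(G)$ is the class of a finite $G$-set $X$. For a finite category $\mathsf{D}$ with an action of $G$, let $\mathsf{D}_n$ be the finite $G$-set of non-degenerate $n$-simplices of the nerve of $\mathsf{D}$ (chains of $n$ composable non-identity morphisms; $\mathsf{D}_0=\mathrm{Obj}(\mathsf{D})$), and let $f_{\mathsf{D}}(t)=\sum_{n\ge 0}[\mathsf{D}_n]\,t^n\in\Omega(G)[[t]]$. One says that $\mathsf{D}$ has series Lefschetz invariant if $f_{\mathsf{D}}$ lies in $\Omega(G)\otimes_{\mathbb{Q}}\mathbb{Q}[t]_{(t+1)}$, that is, if $q f_{\mathsf{D}}=p$ for some $p\in\Omega(G)[t]$ and $q\in\mathbb{Q}[t]$ with $(t+1)\nmid q$; then $\Lambda_{\Sigma}(\mathsf{D}):=f_{\mathsf{D}}(-1)=p(-1)/q(-1)\in\Omega(G)$.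 The fusion category $\mathsf{F}_{\mathscr{S}}$ has object set $\mathscr{S}$, and its morphisms $L\to K$ are the group homomorphisms $L\to K$ of the form $x\mapsto gxg^{-1}$ for some $g\in G$. Let $v\colon\mathsf{F}_{\mathscr{S}}^{\mathrm{op}}\to\{\text{finite }G\text{-sets}\}$ be the functor that sends $K$ to $G/C_G(K)$ and a morphism $L\to K$, $x\mapsto gxg^{-1}$, to the $G$-map $G/C_G(K)\to G/C_G(L)$, $aC_G(K)\mapsto agC_G(L)$. The centralizer decomposition category $E\mathsf{A}_{\mathscr{S}}$ is the Grothendieck construction of $v$: its objects are the pairs $(K,a)$ with $K\in\mathscr{S}$ and $a\in G/C_G(K)$, its morphisms $(K,a)\to(L,b)$ are the morphisms $\varphi\colon K\to L$ in $\mathsf{F}_{\mathscr{S}}^{\mathrm{op}}$ with $v(\varphi)(a)=b$, and $G$ acts by $g\cdot(K,a)=(K,ga)$ on objects and by $g\cdot(\varphi,a)=(\varphi,ga)$ on morphisms. Theorem. The finite $G$-category $E\mathsf{A}_{\mathscr{S}}$ has series Lefschetz invariant, and $$\Lambda_{\Sigma}(E\mathsf{A}_{\mathscr{S}})=\sum_{H\in\mathscr{S}}\frac{-\mu_{\mathscr{S}_-}(-\infty,H)}{|G:C_G(H)|}\,[G/C_G(H)]\in\Omega(G).$$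 Here $\mathscr{S}_-$ is the poset obtained from $\mathscr{S}$ (ordered by inclusion) by adding a unique minimum element $-\infty$, and $\mu_{\mathscr{S}_-}$ is its Möbius function. -/

import Mathlib

open CategoryTheory
open scoped TensorProduct

universe u

/-! ### Finite `G`-sets -/

/-- A finite (left) `G`-set. -/
structure FinGSet (G : Type u) [Group G] where
  carrier : Type u
  [action : MulAction G carrier]
  [finite : Finite carrier]

namespace FinGSet

variable {G : Type u} [Group G]

instance : CoeSort (FinGSet G) (Type u) := ⟨FinGSet.carrier⟩

instance (X : FinGSet G) : MulAction G X := X.action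

instance (X : FinGSet G) : Finite X := X.finite

/-- The category of finite `G`-sets; the morphisms are the `G`-maps. -/
instance : Category (FinGSet G) where
  Hom X Y := X →[G] Y
  id X := MulActionHom.id G
  comp f g := g.comp f

/-- The underlying set of a finite `G`-set, as a functor. -/
def forget (G : Type u) [Group G] : FinGSet G ⥤ Type u where
  obj X := X
  map {X Y} f := ↾(fun x : X => (show X →[G] Y from f) x)

/-- Isomorphism of `G`-sets: there is a `G`-equivariant bijection. -/
def Iso (X Y : FinGSet G) : Prop := ∃ e : X ≃ Y, ∀ (g : G) (x : X), e (g • x) = g • e x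

instance setoid (G : Type u) [Group G] : Setoid (FinGSet G) where
  r := Iso
  iseqv :=
    { refl := fun _ => ⟨Equiv.refl _, fun _ _ => rfl⟩
      symm := fun ⟨e, he⟩ => ⟨e.symm, fun g y => e.injective (by simp [he])⟩
      trans := fun ⟨e, he⟩ ⟨f, hf⟩ => ⟨e.trans f, fun g x => by simp [he, hf]⟩ }

/-- The one-point `G`-set. -/
def point (G : Type u) [Group G] : FinGSet G := ⟨PUnit⟩

/-- The product of two finite `G`-sets, with the diagonal action. -/
def prod (X Y : FinGSet G) : FinGSet G := ⟨X × Y⟩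

/-- The disjoint union of two finite `G`-sets. -/
def sum (X Y : FinGSet G) : FinGSet G := ⟨X ⊕ Y⟩

/-- The transitive `G`-set `G/H`. -/
def quotient [Finite G] (H : Subgroup G) : FinGSet G := ⟨G ⧸ H⟩

/-- Isomorphism classes of finite `G`-sets. -/
def IsoClass (G : Type u) [Group G] : Type (u + 1) := Quotient (setoid G)

/-- The isomorphism class of a finite `G`-set. -/
def toClass (X : FinGSet G) : IsoClass G := Quotient.mk _ X

/-- Isomorphism classes of finite `G`-sets form a commutative monoid under the product. -/
instance : CommMonoid (IsoClass G) where
  mul := Quotient.map₂ prod fun _ _ ⟨e, he⟩ _ _ ⟨f, hf⟩ =>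
    ⟨e.prodCongr f, fun g x => Prod.ext (he g x.1) (hf g x.2)⟩
  mul_assoc := by
    rintro ⟨X⟩ ⟨Y⟩ ⟨Z⟩
    exact Quotient.sound ⟨Equiv.prodAssoc X Y Z, fun _ _ => rfl⟩
  one := toClass (point G)
  one_mul := by
    rintro ⟨X⟩
    exact Quotient.sound ⟨Equiv.punitProd X, fun _ _ => rfl⟩
  mul_one := by
    rintro ⟨X⟩
    exact Quotient.sound ⟨Equiv.prodPUnit X, fun _ _ => rfl⟩
  mul_comm := by
    rintro ⟨X⟩ ⟨Y⟩
    exact Quotient.sound ⟨Equiv.prodComm X Y, fun _ _ => rfl⟩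

end FinGSet

/-! ### The Burnside ring -/

/-- The relations `[X ⊔ Y] = [X] + [Y]` of the Burnside ring. -/
noncomputable def burnsideRelations (G : Type u) [Group G] : Ideal (MonoidAlgebra ℤ (FinGSet.IsoClass G)) :=
  Ideal.span {r | ∃ X Y : FinGSet G, r = MonoidAlgebra.of ℤ _ (X.sum Y).toClass
    - (MonoidAlgebra.of ℤ _ X.toClass + MonoidAlgebra.of ℤ _ Y.toClass)}

/-- The integral Burnside ring: the Grothendieck ring of finite `G`-sets, that is, the commutative
ring generated by the isomorphism classes `[X]` of finite `G`-sets, where `[X] * [Y] = [X × Y]`,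
`1` is the class of the one-point `G`-set and `[X] + [Y] = [X ⊔ Y]`. -/
def IntBurnsideRing (G : Type u) [Group G] : Type (u + 1) :=
  MonoidAlgebra ℤ (FinGSet.IsoClass G) ⧸ burnsideRelations G

noncomputable instance (G : Type u) [Group G] : CommRing (IntBurnsideRing G) :=
  inferInstanceAs (CommRing (MonoidAlgebra ℤ (FinGSet.IsoClass G) ⧸ burnsideRelations G))

/-- The class `[X]` of a finite `G`-set in the integral Burnside ring. -/
noncomputable def intBurnsideClass {G : Type u} [Group G] (X : FinGSet G) : IntBurnsideRing G :=
  Ideal.Quotient.mk (burnsideRelations G) (MonoidAlgebra.of ℤ _ X.toClass)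

/-- The rational Burnside ring `Ω(G)`. -/
def BurnsideRing (G : Type u) [Group G] : Type (u + 1) := ℚ ⊗[ℤ] IntBurnsideRing G

noncomputable instance (G : Type u) [Group G] : CommRing (BurnsideRing G) :=
  inferInstanceAs (CommRing (ℚ ⊗[ℤ] IntBurnsideRing G))

noncomputable instance (G : Type u) [Group G] : Algebra ℚ (BurnsideRing G) :=
  inferInstanceAs (Algebra ℚ (ℚ ⊗[ℤ] IntBurnsideRing G))

/-- The class `[X]` of a finite `G`-set in `Ω(G)`. -/
noncomputable def burnsideClass {G : Type u} [Group G] (X : FinGSet G) : BurnsideRing G :=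
  (1 ⊗ₜ intBurnsideClass X : ℚ ⊗[ℤ] IntBurnsideRing G)

/-! ### Evaluation of power series at `-1` -/

/-- For a commutative `ℚ`-algebra `A`, the power series `f ∈ A[[t]]` lies in `A ⊗ ℚ[t]_(t+1)` and
`f(-1) = L`. After passing to a common denominator, the elements of `A ⊗ ℚ[t]_(t+1)` are the
fractions `p / q` with `p ∈ A[t]`, `q ∈ ℚ[t]` and `(t + 1) ∤ q`, the equation `f = p / q` means
`q f = p`, and the value of the fraction at `-1` is `p(-1) / q(-1)`. -/
def HasValueAtNegOne {A : Type*} [CommRing A] [Algebra ℚ A] (f : PowerSeries A) (L : A) : Prop :=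
  ∃ (p : Polynomial A) (q : Polynomial ℚ),
    ¬ (Polynomial.X + 1 ∣ q) ∧
    ((q.map (algebraMap ℚ A) : Polynomial A) : PowerSeries A) * f = (p : PowerSeries A) ∧
    L = (q.eval (-1))⁻¹ • p.eval (-1)

/-- The value of `f` at `-1` does not depend on the way in which `f` is written as a fraction. -/
theorem HasValueAtNegOne.unique {A : Type*} [CommRing A] [Algebra ℚ A] {f : PowerSeries A}
    {L L' : A} (h : HasValueAtNegOne f L) (h' : HasValueAtNegOne f L') : L = L' := by
  have eval_ne : ∀ {q : Polynomial ℚ}, ¬ (Polynomial.X + 1 ∣ q) → q.eval (-1) ≠ 0 := by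
    intro q hq h
    apply hq
    have := Polynomial.dvd_iff_isRoot.mpr h
    simpa using this
  have eval_map : ∀ r : Polynomial ℚ,
      (r.map (algebraMap ℚ A)).eval (-1) = algebraMap ℚ A (r.eval (-1)) := by
    intro r
    rw [show (-1 : A) = algebraMap ℚ A (-1) by simp, Polynomial.eval_map_algebraMap,
      Polynomial.aeval_algebraMap_apply_eq_algebraMap_eval]
  obtain ⟨p, q, hq, hf, rfl⟩ := h
  obtain ⟨p', q', hq', hf', rfl⟩ := h'
  replace hq := eval_ne hq
  replace hq' := eval_ne hq'
  have h1 : q'.map (algebraMap ℚ A) * p = q.map (algebraMap ℚ A) * p' := by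
    apply Polynomial.coe_injective
    rw [Polynomial.coe_mul, Polynomial.coe_mul, ← hf, ← hf']
    ring
  have h2 := congrArg (Polynomial.eval (-1)) h1
  rw [Polynomial.eval_mul, Polynomial.eval_mul, eval_map, eval_map, ← Algebra.smul_def,
    ← Algebra.smul_def] at h2
  rw [inv_smul_eq_iff₀ hq, smul_comm, ← h2, smul_smul, inv_mul_cancel₀ hq', one_smul]

/-! ### Non-degenerate simplices of the nerve of a category -/

/-- A morphism is an identity morphism. -/
def IsIdentityMor {C : Type u} [Category.{u} C] {x y : C} (f : x ⟶ y) : Prop :=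
  ∃ h : x = y, f = eqToHom h

/-- The non-degenerate `n`-simplices of the nerve of `C` that start at `x`: chains
`x ⟶ x₁ ⟶ ⋯ ⟶ xₙ` of `n` composable morphisms, none of which is an identity. -/
def ChainFrom (C : Type u) [Category.{u} C] : ℕ → C → Type u
  | 0, _ => PUnit
  | n + 1, x => Σ y : C, {f : x ⟶ y // ¬ IsIdentityMor f} × ChainFrom C n y

/-- The set `Cₙ` of all non-degenerate `n`-simplices of the nerve of `C`. -/
def NDSimplex (C : Type u) [Category.{u} C] (n : ℕ) : Type u := Σ x : C, ChainFrom C n x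

/-- The image of a chain under a functor that sends non-identities to non-identities. -/
def ChainFrom.map {C : Type u} [Category.{u} C] (F : C ⥤ C)
    (hF : ∀ {x y : C} (f : x ⟶ y), ¬ IsIdentityMor f → ¬ IsIdentityMor (F.map f)) :
    ∀ (n : ℕ) (x : C), ChainFrom C n x → ChainFrom C n (F.obj x)
  | 0, _, _ => PUnit.unit
  | n + 1, _, ⟨y, f, c⟩ => ⟨F.obj y, ⟨F.map f.1, hF f.1 f.2⟩, ChainFrom.map F hF n y c⟩

/-- A category has finitely many objects and finitely many morphisms. -/
class IsFiniteCat (C : Type u) [Category.{u} C] : Prop where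
  finite_obj : Finite C
  finite_hom : ∀ x y : C, Finite (x ⟶ y)

instance {C : Type u} [Category.{u} C] [h : IsFiniteCat C] (n : ℕ) : Finite (NDSimplex C n) := by
  have := h.finite_obj
  have := h.finite_hom
  have key : ∀ (n : ℕ) (x : C), Finite (ChainFrom C n x) := by
    intro n
    induction n with
    | zero => intro x; exact inferInstanceAs (Finite PUnit)
    | succ n ih =>
      intro x
      exact inferInstanceAs (Finite (Σ y : C, {f : x ⟶ y // ¬ IsIdentityMor f} × ChainFrom C n y))
  have := key n
  exact inferInstanceAs (Finite (Σ x : C, ChainFrom C n x))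

/-! ### `G`-categories and the series Lefschetz invariant

A `G`-category, that is, a category with a (strict) left action of the group `G` by functors, is
an object of `Action Cat G`. -/

namespace GCat

variable {G : Type u} [Group G]

/-- The functor by which `g : G` acts on the `G`-category `D`. -/
abbrev act (D : Action Cat.{u, u} G) (g : G) : D.V ⥤ D.V := (D.ρ g).toFunctor

theorem act_one (D : Action Cat.{u, u} G) : act D 1 = 𝟭 D.V := by
  have h : D.ρ 1 = 𝟙 D.V := map_one D.ρ
  exact congrArg Cat.Hom.toFunctor h

theorem act_mul (D : Action Cat.{u, u} G) (g h : G) : act D (g * h) = act D h ⋙ act D g := by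
  have h : D.ρ (g * h) = D.ρ h ≫ D.ρ g := map_mul D.ρ g h
  exact congrArg Cat.Hom.toFunctor h

theorem isIdentityMor_map {C : Type u} [Category.{u} C] (F : C ⥤ C) {x y : C} {f : x ⟶ y}
    (hf : IsIdentityMor f) : IsIdentityMor (F.map f) := by
  obtain ⟨rfl, rfl⟩ := hf
  exact ⟨rfl, by simp⟩

theorem act_not_isIdentityMor (D : Action Cat.{u, u} G) (g : G) {x y : D.V} (f : x ⟶ y)
    (hf : ¬ IsIdentityMor f) : ¬ IsIdentityMor ((act D g).map f) := by
  intro h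
  have h1 : IsIdentityMor ((act D g ⋙ act D g⁻¹).map f) := isIdentityMor_map (act D g⁻¹) h
  rw [← act_mul, inv_mul_cancel, act_one] at h1
  exact hf h1

/-- The action of `G` on the non-degenerate `n`-simplices of a `G`-category. -/
def smulSimplex (D : Action Cat.{u, u} G) (n : ℕ) (g : G) (σ : NDSimplex D.V n) :
    NDSimplex D.V n :=
  ⟨(act D g).obj σ.1, ChainFrom.map (act D g) (act_not_isIdentityMor D g) n σ.1 σ.2⟩

theorem map_eq_of_eq_id {C : Type u} [Category.{u} C] (F : C ⥤ C) (h : F = 𝟭 C)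
    (hF : ∀ {x y : C} (f : x ⟶ y), ¬ IsIdentityMor f → ¬ IsIdentityMor (F.map f))
    (n : ℕ) (x : C) (c : ChainFrom C n x) :
    (⟨F.obj x, ChainFrom.map F hF n x c⟩ : NDSimplex C n) = ⟨x, c⟩ := by
  subst h
  have key : ∀ (n : ℕ) (x : C) (c : ChainFrom C n x),
      ChainFrom.map (𝟭 C) hF n x c = c := by
    intro n
    induction n with
    | zero => intro x c; rfl
    | succ n ih =>
      rintro x ⟨y, f, c⟩
      simp only [ChainFrom.map, ih]
      rfl
  exact congrArg (Sigma.mk x) (key n x c)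

theorem map_eq_of_eq_comp {C : Type u} [Category.{u} C] (F F₁ F₂ : C ⥤ C) (h : F = F₁ ⋙ F₂)
    (hF : ∀ {x y : C} (f : x ⟶ y), ¬ IsIdentityMor f → ¬ IsIdentityMor (F.map f))
    (hF₁ : ∀ {x y : C} (f : x ⟶ y), ¬ IsIdentityMor f → ¬ IsIdentityMor (F₁.map f))
    (hF₂ : ∀ {x y : C} (f : x ⟶ y), ¬ IsIdentityMor f → ¬ IsIdentityMor (F₂.map f))
    (n : ℕ) (x : C) (c : ChainFrom C n x) :
    (⟨F.obj x, ChainFrom.map F hF n x c⟩ : NDSimplex C n) =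
      ⟨F₂.obj (F₁.obj x), ChainFrom.map F₂ hF₂ n _ (ChainFrom.map F₁ hF₁ n x c)⟩ := by
  subst h
  have key : ∀ (n : ℕ) (x : C) (c : ChainFrom C n x),
      ChainFrom.map (F₁ ⋙ F₂) hF n x c =
        ChainFrom.map F₂ hF₂ n _ (ChainFrom.map F₁ hF₁ n x c) := by
    intro n
    induction n with
    | zero => intro x c; rfl
    | succ n ih =>
      rintro x ⟨y, f, c⟩
      simp only [ChainFrom.map, ih]
      rfl
  exact congrArg (Sigma.mk _) (key n x c)

instance (D : Action Cat.{u, u} G) (n : ℕ) : MulAction G (NDSimplex D.V n) where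
  smul g σ := smulSimplex D n g σ
  one_smul σ := map_eq_of_eq_id _ (act_one D) _ n σ.1 σ.2
  mul_smul g h σ := map_eq_of_eq_comp _ _ _ (act_mul D g h) _ _ _ n σ.1 σ.2

/-- The finite `G`-set `Dₙ` of non-degenerate `n`-simplices of a finite `G`-category `D`. -/
def simplices (D : Action Cat.{u, u} G) [IsFiniteCat D.V] (n : ℕ) : FinGSet G :=
  ⟨NDSimplex D.V n⟩

/-- The power series `f_D(t) = ∑ₙ [Dₙ] tⁿ` with coefficients in `Ω(G)`. -/
noncomputable def series (D : Action Cat.{u, u} G) [IsFiniteCat D.V] :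
    PowerSeries (BurnsideRing G) :=
  PowerSeries.mk fun n => burnsideClass (simplices D n)

/-- The finite `G`-category `D` has a series Lefschetz invariant: `f_D` lies in
`Ω(G) ⊗ ℚ[t]_(t+1)`. -/
def HasSeriesLefschetz (D : Action Cat.{u, u} G) [IsFiniteCat D.V] : Prop :=
  ∃ L : BurnsideRing G, HasValueAtNegOne (series D) L

/-- The series Lefschetz invariant `f_D(-1)` of a finite `G`-category that has one. -/
noncomputable def seriesLefschetz (D : Action Cat.{u, u} G) [IsFiniteCat D.V]
    (h : HasSeriesLefschetz D) : BurnsideRing G :=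
  h.choose

/-! ### Grothendieck constructions of functors to finite `G`-sets -/

section Grothendieck

variable {C : Type u} [Category.{u} C]

/-- The action of `g` on the Grothendieck construction of `F : C ⥤ FinGSet G`, given by
`g • (x, a) = (x, g • a)` on objects and `g • (φ, a) = (φ, g • a)` on morphisms. -/
def grothendieckAct (F : C ⥤ FinGSet G) (g : G) :
    (F ⋙ FinGSet.forget G).Elements ⥤ (F ⋙ FinGSet.forget G).Elements where
  obj x := ⟨x.1, (g • (show F.obj x.1 from x.2) : F.obj x.1)⟩
  map {x y} f := ⟨f.1, by
    have h : (show F.obj x.1 →[G] F.obj y.1 from F.map f.1) x.2 = y.2 := f.2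
    exact ((show F.obj x.1 →[G] F.obj y.1 from F.map f.1).map_smul g x.2).trans
      (congrArg (fun a : F.obj y.1 => g • a) h)⟩

theorem grothendieck_ext (F : C ⥤ FinGSet G)
    {H₁ H₂ : (F ⋙ FinGSet.forget G).Elements ⥤ (F ⋙ FinGSet.forget G).Elements}
    (h_obj : ∀ x, H₁.obj x = H₂.obj x)
    (h_map : ∀ {x y : (F ⋙ FinGSet.forget G).Elements} (f : x ⟶ y),
      HEq (H₁.map f).1 (H₂.map f).1) : H₁ = H₂ :=
  Functor.hext h_obj fun x y f => key (h_obj x) (h_obj y) _ _ (h_map f)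
where
  key {X X' Y Y' : (F ⋙ FinGSet.forget G).Elements} (hX : X = X') (hY : Y = Y') (f : X ⟶ Y)
      (f' : X' ⟶ Y') (h : HEq f.1 f'.1) : HEq f f' := by
    subst hX hY
    exact heq_of_eq (Subtype.ext (eq_of_heq h))

/-- The Grothendieck construction of a functor `F` to finite `G`-sets, as a `G`-category: the
objects are the pairs `(x, a)` with `a ∈ F(x)`, and the morphisms `(x, a) ⟶ (y, b)` are the
morphisms `φ : x ⟶ y` with `F(φ)(a) = b`. -/
def grothendieck (F : C ⥤ FinGSet G) : Action Cat.{u, u} G where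
  V := Cat.of (F ⋙ FinGSet.forget G).Elements
  ρ :=
    { toFun := fun g => (grothendieckAct F g).toCatHom
      map_one' := by
        refine congrArg Functor.toCatHom (grothendieck_ext F ?_ fun f => HEq.rfl)
        intro x
        exact congrArg (Sigma.mk x.1) (one_smul G (show F.obj x.1 from x.2))
      map_mul' := fun g h => by
        refine congrArg Functor.toCatHom (grothendieck_ext F
          (H₂ := grothendieckAct F h ⋙ grothendieckAct F g) ?_ fun f => HEq.rfl)
        intro x
        exact congrArg (Sigma.mk x.1) (mul_smul g h (show F.obj x.1 from x.2)) }

instance [h : IsFiniteCat C] (F : C ⥤ FinGSet G) : IsFiniteCat (grothendieck F).V where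
  finite_obj := by
    have := h.finite_obj
    exact inferInstanceAs (Finite (Σ x : C, F.obj x))
  finite_hom x y := by
    have := h.finite_hom
    exact Finite.of_injective (fun f : (show (F ⋙ FinGSet.forget G).Elements from x) ⟶
      (show (F ⋙ FinGSet.forget G).Elements from y) => f.1) Subtype.val_injective

end Grothendieck

end GCat

/-! ### The fusion category and the centralizer decomposition category -/

/-- The objects of the fusion category of a set `S` of subgroups: the members of `S`. -/
@[ext]
structure FusionCat {G : Type u} [Group G] (S : Set (Subgroup G)) where
  grp : Subgroup G
  mem : grp ∈ S

namespace FusionCat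

variable {G : Type u} [Group G] {S : Set (Subgroup G)}

/-- A group homomorphism `L → K` is induced by conjugation by `g`, i.e. it is `x ↦ g x g⁻¹`. -/
def IsConjBy {L K : Subgroup G} (φ : L →* K) (g : G) : Prop :=
  ∀ x : L, (φ x : G) = g * x * g⁻¹

theorem isConjBy_comp {L K M : Subgroup G} {φ : L →* K} {ψ : K →* M} {g h : G}
    (hg : IsConjBy φ g) (hh : IsConjBy ψ h) : IsConjBy (ψ.comp φ) (h * g) :=
  fun x => by simp [hh _, hg x, mul_assoc]

/-- The morphisms of the fusion category are the group homomorphisms that are induced by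
conjugation by an element of `G`. -/
instance : Category (FusionCat S) where
  Hom L K := {φ : L.grp →* K.grp // ∃ g : G, IsConjBy φ g}
  id L := ⟨MonoidHom.id _, 1, fun x => by simp⟩
  comp := fun {L K M} φ ψ => ⟨ψ.1.comp φ.1, by
    obtain ⟨g, hg⟩ := φ.2
    obtain ⟨h, hh⟩ := ψ.2
    exact ⟨h * g, isConjBy_comp hg hh⟩⟩

instance [Finite G] : IsFiniteCat (FusionCat S) where
  finite_obj := Finite.of_injective FusionCat.grp fun _ _ h => FusionCat.ext h
  finite_hom L K := by
    have : Finite (L.grp →* K.grp) := Finite.of_injective _ DFunLike.coe_injective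
    exact inferInstanceAs (Finite {φ : L.grp →* K.grp // ∃ g : G, IsConjBy φ g})

instance [Finite G] : IsFiniteCat (FusionCat S)ᵒᵖ where
  finite_obj := by
    have := IsFiniteCat.finite_obj (C := FusionCat S)
    exact Finite.of_equiv _ Opposite.equivToOpposite
  finite_hom K L := by
    have := IsFiniteCat.finite_hom (C := FusionCat S) L.unop K.unop
    exact Finite.of_equiv _ (opEquiv K L).symm

/-- The centralizer `C_G(H)` of a subgroup. -/
abbrev cent (H : Subgroup G) : Subgroup G := Subgroup.centralizer (H : Set G)

/-- If `φ : L → K` is conjugation by `g`, then `x C_G(K) ↦ x g C_G(L)` is well defined. -/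
theorem conj_mem {L K : Subgroup G} {φ : L →* K} {g : G} (hg : IsConjBy φ g) {c : G}
    (hc : c ∈ cent K) : g⁻¹ * c * g ∈ cent L := by
  rw [Subgroup.mem_centralizer_iff] at hc ⊢
  intro x hx
  have h := hc (φ ⟨x, hx⟩) (φ ⟨x, hx⟩).2
  rw [hg] at h
  simp only at h
  calc x * (g⁻¹ * c * g) = g⁻¹ * (g * x * g⁻¹ * c) * g := by group
    _ = g⁻¹ * (c * (g * x * g⁻¹)) * g := by rw [h]
    _ = g⁻¹ * c * g * x := by group

/-- The `G`-map `G/C_G(K) → G/C_G(L)`, `x C_G(K) ↦ x g C_G(L)`, if `φ : L → K` is conjugation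
by `g`. -/
def centMapOf {L K : Subgroup G} {φ : L →* K} {g : G} (hg : IsConjBy φ g) :
    (G ⧸ cent K) →[G] (G ⧸ cent L) where
  toFun := Quotient.map' (fun x => x * g) fun a b hab => by
    rw [QuotientGroup.leftRel_apply] at hab ⊢
    simpa [mul_assoc] using conj_mem hg hab
  map_smul' a := by
    rintro ⟨x⟩
    exact congrArg (QuotientGroup.mk (s := cent L)) (mul_assoc a x g)

/-- This `G`-map depends only on `φ`, not on the element `g`. -/
theorem centMapOf_eq {L K : Subgroup G} {φ : L →* K} {g g' : G} (hg : IsConjBy φ g)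
    (hg' : IsConjBy φ g') : centMapOf hg = centMapOf hg' := by
  ext ⟨x⟩
  refine QuotientGroup.eq.mpr ?_
  rw [Subgroup.mem_centralizer_iff]
  intro y hy
  have h := (hg ⟨y, hy⟩).symm.trans (hg' ⟨y, hy⟩)
  simp only at h
  calc y * ((x * g)⁻¹ * (x * g')) = g⁻¹ * (g * y * g⁻¹) * g' := by group
    _ = g⁻¹ * (g' * y * g'⁻¹) * g' := by rw [h]
    _ = (x * g)⁻¹ * (x * g') * y := by group

/-- The functor `F_Sᵒᵖ ⥤ {finite G-sets}` that sends `K` to `G/C_G(K)` and a morphism `L → K` of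
the fusion category, given by conjugation by `g`, to the `G`-map `x C_G(K) ↦ x g C_G(L)`. -/
noncomputable def centFunctor [Finite G] (S : Set (Subgroup G)) :
    (FusionCat S)ᵒᵖ ⥤ FinGSet G where
  obj K := FinGSet.quotient (cent K.unop.grp)
  map φ := centMapOf φ.unop.2.choose_spec
  map_id K := (centMapOf_eq (𝟙 K : K ⟶ K).unop.2.choose_spec
    (g' := 1) (fun x => by simp [CategoryStruct.id])).trans (by
      ext ⟨x⟩
      exact congrArg (QuotientGroup.mk (s := cent K.unop.grp)) (mul_one x))
  map_comp {K L M} φ ψ := (centMapOf_eq (φ ≫ ψ).unop.2.choose_spec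
    (isConjBy_comp ψ.unop.2.choose_spec φ.unop.2.choose_spec)).trans (by
      ext ⟨x⟩
      exact congrArg (QuotientGroup.mk (s := cent M.unop.grp)) (mul_assoc x _ _).symm)

end FusionCat

/-- The centralizer decomposition category `EA_S`: the Grothendieck construction of the functor
`F_Sᵒᵖ ⥤ {finite G-sets}`, `K ↦ G/C_G(K)`. -/
noncomputable def centralizerDecomposition {G : Type u} [Group G] [Finite G]
    (S : Set (Subgroup G)) : Action Cat.{u, u} G :=
  GCat.grothendieck (FusionCat.centFunctor S)

instance {G : Type u} [Group G] [Finite G] (S : Set (Subgroup G)) :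
    IsFiniteCat (centralizerDecomposition S).V :=
  inferInstanceAs (IsFiniteCat (GCat.grothendieck (FusionCat.centFunctor S)).V)

/-! ### The Möbius function of a finite poset -/

open Classical in
/-- The Möbius function of a finite poset `P`, with rational values. -/
noncomputable def mobius {P : Type u} [PartialOrder P] [Finite P] (a b : P) : ℚ :=
  letI := Fintype.ofFinite P
  letI : LocallyFiniteOrder P := Fintype.toLocallyFiniteOrder
  IncidenceAlgebra.mu ℚ a b

/-!
The series of any Grothendieck construction `∫F` of a functor `F : C ⥤ {finite G-sets}` can be read
off from `C`. A chain of `∫F` that starts at `(x, a)` is determined by its image in `C`, since the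
later second coordinates are the images of `a`, and a morphism of `∫F` is an identity exactly if its
image in `C` is one. Hence the `n`-simplices form the `G`-set of pairs of an `n`-simplex of `C` and
an element of the value of `F` at its first vertex (`GCat.simplicesEquiv`), and
`[(∫F)ₙ] = ∑ x, cₙ(x) [F x]`, where `cₙ(x)` is the number of non-degenerate `n`-chains of `C` that
start at `x`. It remains to evaluate the rational power series `c_K(t) = ∑ₙ cₙ(K) tⁿ` of the
category `F_Sᵒᵖ` at `-1`.

Removing the first morphism of a chain gives `cₙ₊₁(K) = ∑ L, |Hom(L, K)| cₙ(L) - cₙ(K)`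
(`chainCount_succ`). A morphism `L → K` of the fusion category is conjugation by exactly `|C_G(L)|`
elements of `G`, and `cₙ` is constant on conjugacy classes, so averaging over `G` turns the sum into
`∑_{H ≤ K} |G : C_G(H)| cₙ(H)` (`FusionCat.sum_card_hom_mul`). With `m_H = |G : C_G(H)|` this says
`(1 + (1 - m_K) t) c_K(t) = 1 + t ∑_{H < K} m_H c_H(t)`. The factor on the left has the non-zero
value `m_K` at `-1`, so by induction on `K` every `c_K` has a value at `-1`, and
`∑_{H ≤ K} m_H c_H(-1) = 1` for all `K`. The numbers `-μ(-∞, H)` solve the same triangular system,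
so `c_H(-1) = -μ(-∞, H) / m_H` (`hasValueAtNegOne_of_recurrence`).
-/

/-! ### Calculus of values at `-1` -/

namespace HasValueAtNegOne

variable {A : Type*} [CommRing A] [Algebra ℚ A]

theorem X_add_one_dvd_iff {q : Polynomial ℚ} : Polynomial.X + 1 ∣ q ↔ q.eval (-1) = 0 := by
  have h := Polynomial.dvd_iff_isRoot (p := q) (a := -1)
  simpa using h

theorem eval_map_algebraMap (r : Polynomial ℚ) :
    (r.map (algebraMap ℚ A)).eval (-1) = algebraMap ℚ A (r.eval (-1)) := by
  rw [show (-1 : A) = algebraMap ℚ A (-1) by simp, Polynomial.eval_map_algebraMap,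
    Polynomial.aeval_algebraMap_apply_eq_algebraMap_eval]

theorem of_fraction {f : PowerSeries A} {L : A} (p : Polynomial A) (q : Polynomial ℚ)
    (hq : q.eval (-1) ≠ 0)
    (hf : ((q.map (algebraMap ℚ A) : Polynomial A) : PowerSeries A) * f = (p : PowerSeries A))
    (hL : q.eval (-1) • L = p.eval (-1)) : HasValueAtNegOne f L :=
  ⟨p, q, fun h => hq (X_add_one_dvd_iff.mp h), hf, (inv_smul_eq_iff₀ hq).mpr hL.symm |>.symm⟩

theorem exists_fraction {f : PowerSeries A} {L : A} (h : HasValueAtNegOne f L) :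
    ∃ (p : Polynomial A) (q : Polynomial ℚ), q.eval (-1) ≠ 0 ∧
      ((q.map (algebraMap ℚ A) : Polynomial A) : PowerSeries A) * f = (p : PowerSeries A) ∧
      q.eval (-1) • L = p.eval (-1) := by
  obtain ⟨p, q, hq, hf, rfl⟩ := h
  have hq' : q.eval (-1) ≠ 0 := fun h => hq (X_add_one_dvd_iff.mpr h)
  exact ⟨p, q, hq', hf, smul_inv_smul₀ hq' _⟩

theorem polynomial (p : Polynomial A) : HasValueAtNegOne (p : PowerSeries A) (p.eval (-1)) :=
  of_fraction p 1 (by simp) (by simp) (by simp)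

theorem add {f g : PowerSeries A} {L M : A} (hf : HasValueAtNegOne f L)
    (hg : HasValueAtNegOne g M) : HasValueAtNegOne (f + g) (L + M) := by
  obtain ⟨p, q, hq, hf, hL⟩ := hf.exists_fraction
  obtain ⟨p', q', hq', hg, hM⟩ := hg.exists_fraction
  refine of_fraction (q'.map (algebraMap ℚ A) * p + q.map (algebraMap ℚ A) * p') (q * q') ?_ ?_ ?_
  · rw [Polynomial.eval_mul]; exact mul_ne_zero hq hq'
  · rw [Polynomial.map_mul, Polynomial.coe_mul, Polynomial.coe_add, Polynomial.coe_mul,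
      Polynomial.coe_mul, ← hf, ← hg]
    ring
  · simp only [Polynomial.eval_add, Polynomial.eval_mul, eval_map_algebraMap, ← hL, ← hM,
      Algebra.smul_def, map_mul]
    ring

theorem sum {ι : Type*} (s : Finset ι) {f : ι → PowerSeries A} {L : ι → A}
    (h : ∀ i ∈ s, HasValueAtNegOne (f i) (L i)) :
    HasValueAtNegOne (∑ i ∈ s, f i) (∑ i ∈ s, L i) := by
  classical
  induction s using Finset.induction_on with
  | empty => simpa using polynomial (0 : Polynomial A)
  | insert i s hi ih =>
    rw [Finset.sum_insert hi, Finset.sum_insert hi]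
    exact (h i (Finset.mem_insert_self i s)).add
      (ih fun j hj => h j (Finset.mem_insert_of_mem hj))

theorem polynomial_mul (r : Polynomial A) {f : PowerSeries A} {L : A}
    (h : HasValueAtNegOne f L) :
    HasValueAtNegOne ((r : PowerSeries A) * f) (r.eval (-1) * L) := by
  obtain ⟨p, q, hq, hf, hL⟩ := h.exists_fraction
  refine of_fraction (r * p) q hq ?_ ?_
  · rw [Polynomial.coe_mul, ← hf]; ring
  · rw [Polynomial.eval_mul, ← hL, mul_smul_comm]

/-- A factor from `ℚ[t]` that does not vanish at `-1` can be cancelled. -/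
theorem of_mul {r : Polynomial ℚ} (hr : r.eval (-1) ≠ 0) {f : PowerSeries A} {L : A}
    (h : HasValueAtNegOne (((r.map (algebraMap ℚ A) : Polynomial A) : PowerSeries A) * f)
      (r.eval (-1) • L)) : HasValueAtNegOne f L := by
  obtain ⟨p, q, hq, hf, hL⟩ := h.exists_fraction
  refine of_fraction p (q * r) ?_ ?_ ?_
  · rw [Polynomial.eval_mul]; exact mul_ne_zero hq hr
  · rw [Polynomial.map_mul, Polynomial.coe_mul, mul_assoc, hf]
  · rw [Polynomial.eval_mul, mul_smul, hL]

/-- Values pass from `ℚ[[t]]` to `A[[t]]` along `x ↦ x • a`. -/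
theorem mk_smul {f : ℕ → ℚ} {l : ℚ} (h : HasValueAtNegOne (PowerSeries.mk f) l) (a : A) :
    HasValueAtNegOne (PowerSeries.mk fun n => f n • a) (l • a) := by
  obtain ⟨p, q, hq, hf, hl⟩ := h.exists_fraction
  have hmk : (PowerSeries.mk fun n => f n • a) =
      PowerSeries.map (algebraMap ℚ A) (PowerSeries.mk f) * PowerSeries.C a := by
    ext n
    simp [Algebra.smul_def]
  refine of_fraction (p.map (algebraMap ℚ A) * Polynomial.C a) q hq ?_ ?_
  · rw [Algebra.algebraMap_self, Polynomial.map_id] at hf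
    rw [hmk, ← mul_assoc, Polynomial.polynomial_map_coe, ← map_mul, hf, Polynomial.coe_mul,
      Polynomial.polynomial_map_coe, Polynomial.coe_C]
  · rw [Polynomial.eval_mul, eval_map_algebraMap, Polynomial.eval_C, ← hl, smul_smul,
      smul_eq_mul, Algebra.smul_def]

end HasValueAtNegOne

/-! ### Classes of disjoint unions in the Burnside ring -/

section BurnsideClass

variable {G : Type u} [Group G]

/-- The disjoint union of a finite family of finite `G`-sets. -/
def FinGSet.sigma {ι : Type u} [Finite ι] (Y : ι → FinGSet G) : FinGSet G := ⟨Σ i, Y i⟩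

theorem burnsideClass_congr {X Y : FinGSet G} (e : X ≃ Y)
    (he : ∀ (g : G) (x : X), e (g • x) = g • e x) : burnsideClass X = burnsideClass Y := by
  have h : X.toClass = Y.toClass := Quotient.sound ⟨e, he⟩
  rw [burnsideClass, burnsideClass, intBurnsideClass, intBurnsideClass, h]

theorem burnsideClass_sum (X Y : FinGSet G) :
    burnsideClass (X.sum Y) = burnsideClass X + burnsideClass Y := by
  have h : intBurnsideClass (X.sum Y) = intBurnsideClass X + intBurnsideClass Y :=
    Ideal.Quotient.eq.mpr (Ideal.subset_span ⟨X, Y, rfl⟩)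
  rw [burnsideClass, h]
  exact TensorProduct.tmul_add _ _ _

theorem burnsideClass_of_isEmpty (X : FinGSet G) [IsEmpty X] : burnsideClass X = 0 := by
  have h : burnsideClass (X.sum X) = burnsideClass X :=
    burnsideClass_congr (Equiv.emptySum X X) (by rintro g (x | x) <;> exact isEmptyElim x)
  rw [burnsideClass_sum] at h
  simpa using h

theorem burnsideClass_sigma {ι : Type u} [Fintype ι] (Y : ι → FinGSet G) :
    burnsideClass (FinGSet.sigma Y) = ∑ i, burnsideClass (Y i) := by
  revert Y
  refine Fintype.induction_empty_option
    (P := fun ι _ => ∀ Y : ι → FinGSet G,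
      burnsideClass (FinGSet.sigma Y) = ∑ i, burnsideClass (Y i)) ?_ ?_ ?_ ι
  · intro α β _ e ih Y
    let := Fintype.ofEquiv β e.symm
    rw [← e.sum_comp, ← ih]
    refine (burnsideClass_congr (Equiv.sigmaCongrLeft (β := fun b => (Y b).carrier) e) ?_).symm
    rintro g ⟨i, x⟩
    rfl
  · intro Y
    have : IsEmpty (FinGSet.sigma Y) := inferInstanceAs (IsEmpty (Σ i, Y i))
    simp [burnsideClass_of_isEmpty]
  · intro α _ ih Y
    rw [Fintype.sum_option, ← ih, ← burnsideClass_sum]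
    refine burnsideClass_congr
      ⟨fun x => match x with
        | ⟨none, y⟩ => Sum.inl y
        | ⟨some i, y⟩ => Sum.inr ⟨i, y⟩,
       fun x => match x with
        | Sum.inl y => ⟨none, y⟩
        | Sum.inr ⟨i, y⟩ => ⟨some i, y⟩, ?_, ?_⟩ ?_
    · rintro ⟨_ | i, y⟩ <;> rfl
    · rintro (y | ⟨i, y⟩) <;> rfl
    · rintro g ⟨_ | i, y⟩ <;> rfl

end BurnsideClass

/-! ### Simplices of a Grothendieck construction -/

namespace GCat

variable {G : Type u} [Group G] {C : Type u} [Category.{u} C] (F : C ⥤ FinGSet G)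

/-- Above an identity `𝟙 x` of `C` lie only identities: a morphism `(x, a) ⟶ (x, b)` above it forces
`a = b`. -/
theorem isIdentityMor_val_iff {x y : (F ⋙ FinGSet.forget G).Elements} (f : x ⟶ y) :
    IsIdentityMor f.1 ↔ IsIdentityMor f := by
  constructor
  · obtain ⟨x, a⟩ := x
    obtain ⟨y, b⟩ := y
    obtain ⟨f, hf⟩ := f
    rintro ⟨h, hf'⟩
    dsimp only at h hf'
    subst h
    have hf1 : f = 𝟙 x := hf'
    subst hf1
    have hab : a = b := by simpa using hf
    subst hab
    exact ⟨rfl, Subtype.ext rfl⟩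
  · rintro ⟨rfl, rfl⟩
    exact ⟨rfl, rfl⟩

/-- A non-degenerate chain of the Grothendieck construction of `F` that starts at `(x, a)` is
determined by the underlying chain of `C`, which is an arbitrary non-degenerate chain that starts
at `x`. -/
def chainEquiv : ∀ (n : ℕ) (x : (F ⋙ FinGSet.forget G).Elements),
    ChainFrom (F ⋙ FinGSet.forget G).Elements n x ≃ ChainFrom C n x.1
  | 0, _ => Equiv.refl PUnit
  | n + 1, x =>
    { toFun := fun c =>
        ⟨c.1.1, ⟨c.2.1.1.1, fun h => c.2.1.2 ((isIdentityMor_val_iff F _).mp h)⟩,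
          chainEquiv n c.1 c.2.2⟩
      invFun := fun c =>
        ⟨⟨c.1, (F ⋙ FinGSet.forget G).map c.2.1.1 x.2⟩,
          ⟨⟨c.2.1.1, rfl⟩, fun h => c.2.1.2 ((isIdentityMor_val_iff F _).mpr h)⟩,
          (chainEquiv n ⟨c.1, (F ⋙ FinGSet.forget G).map c.2.1.1 x.2⟩).symm c.2.2⟩
      left_inv := by
        rintro ⟨⟨y, b⟩, ⟨⟨f, hf⟩, hf'⟩, c⟩
        -- Restate the type of `f` without `b`, so that `b` can be eliminated.
        revert f
        intro (f : x.1 ⟶ y) (hf : (F ⋙ FinGSet.forget G).map f x.2 = b) hf'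
        subst hf
        simp only [Equiv.symm_apply_apply]
        rfl
      right_inv := by
        rintro ⟨y, f, c⟩
        simp only [Equiv.apply_symm_apply]
        rfl }

/-- The action of `G` does not change the underlying chain of `C`. -/
theorem chainEquiv_map (g : G) : ∀ (n : ℕ) (x : (F ⋙ FinGSet.forget G).Elements)
    (c : ChainFrom (F ⋙ FinGSet.forget G).Elements n x),
    chainEquiv F n ((grothendieckAct F g).obj x)
      (ChainFrom.map (grothendieckAct F g)
        (act_not_isIdentityMor (grothendieck F) g) n x c) = chainEquiv F n x c
  | 0, _, _ => rfl
  | n + 1, x, ⟨y, f, c⟩ => by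
    have ih := chainEquiv_map g n y c
    exact congrArg (fun d => (⟨y.1, ⟨f.1.1, fun h => f.2 ((isIdentityMor_val_iff F _).mp h)⟩, d⟩ :
      ChainFrom C (n + 1) x.1)) ih

/-- The non-degenerate `n`-simplices of the Grothendieck construction of `F` are the pairs of a
non-degenerate `n`-simplex of `C` and an element of the value of `F` at its initial vertex. -/
def simplicesEquiv (n : ℕ) :
    NDSimplex (F ⋙ FinGSet.forget G).Elements n ≃ Σ σ : NDSimplex C n, F.obj σ.1 where
  toFun σ := ⟨⟨σ.1.1, chainEquiv F n σ.1 σ.2⟩, σ.1.2⟩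
  invFun σ := ⟨⟨σ.1.1, σ.2⟩, (chainEquiv F n ⟨σ.1.1, σ.2⟩).symm σ.1.2⟩
  left_inv := by
    rintro ⟨⟨x, a⟩, c⟩
    exact congrArg (Sigma.mk _) ((chainEquiv F n ⟨x, a⟩).symm_apply_apply c)
  right_inv := by
    rintro ⟨⟨x, c⟩, a⟩
    exact congrArg (fun d => (⟨⟨x, d⟩, a⟩ : Σ σ : NDSimplex C n, F.obj σ.1))
      ((chainEquiv F n ⟨x, a⟩).apply_symm_apply c)

theorem simplicesEquiv_smul (n : ℕ) (g : G) (σ : NDSimplex (grothendieck F).V n) :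
    simplicesEquiv F n (g • σ) = g • simplicesEquiv F n σ := by
  obtain ⟨x, c⟩ := σ
  exact congrArg (fun d => (⟨⟨x.1, d⟩, (g • (show F.obj x.1 from x.2) : F.obj x.1)⟩ :
    Σ σ : NDSimplex C n, F.obj σ.1)) (chainEquiv_map F g n x c)

end GCat

/-! ### Counting chains -/

section CountChains

variable {C : Type u} [Category.{u} C]

instance [h : IsFiniteCat C] (n : ℕ) (x : C) : Finite (ChainFrom C n x) :=
  Finite.of_injective (β := NDSimplex C n) (fun c => ⟨x, c⟩) sigma_mk_injective

/-- The number of non-degenerate chains of length `n` that start at `x`. -/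
noncomputable def chainCount (n : ℕ) (x : C) : ℚ := Nat.card (ChainFrom C n x)

theorem chainCount_zero (x : C) : chainCount 0 x = 1 := by
  have : Nat.card (ChainFrom C 0 x) = 1 := Nat.card_unique (α := PUnit.{u + 1})
  simp [chainCount, this]

open Classical in
theorem card_not_isIdentityMor [IsFiniteCat C] (x y : C) :
    (Nat.card {f : x ⟶ y // ¬ IsIdentityMor f} : ℚ) =
      Nat.card (x ⟶ y) - if x = y then 1 else 0 := by
  have := IsFiniteCat.finite_hom x y
  have h1 : Nat.card {f : x ⟶ y // IsIdentityMor f} = if x = y then 1 else 0 := by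
    split_ifs with h
    · subst h
      rw [Nat.card_eq_one_iff_unique]
      exact ⟨⟨fun ⟨f, _, hf⟩ ⟨g, _, hg⟩ => Subtype.ext (hf.trans hg.symm)⟩, ⟨𝟙 x, rfl, rfl⟩⟩
    · rw [Nat.card_eq_zero]
      exact Or.inl ⟨fun ⟨f, h', _⟩ => h h'⟩
  have h2 := Nat.card_congr (Equiv.sumCompl fun f : x ⟶ y => IsIdentityMor f)
  rw [Nat.card_sum, h1] at h2
  rw [← h2]
  push_cast
  ring

theorem chainCount_succ [IsFiniteCat C] [Fintype C] (n : ℕ) (x : C) :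
    chainCount (n + 1) x = ∑ y, (Nat.card (x ⟶ y) : ℚ) * chainCount n y - chainCount n x := by
  classical
  have := IsFiniteCat.finite_hom (C := C)
  have h : Nat.card (ChainFrom C (n + 1) x) =
      ∑ y, Nat.card {f : x ⟶ y // ¬ IsIdentityMor f} * Nat.card (ChainFrom C n y) := by
    rw [ChainFrom, Nat.card_sigma]
    simp only [Nat.card_prod]
  rw [chainCount, h]
  push_cast
  simp only [card_not_isIdentityMor, sub_mul, Finset.sum_sub_distrib, ite_mul, one_mul, zero_mul,
    Finset.sum_ite_eq, Finset.mem_univ, if_true]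
  rfl

theorem chainCount_eq_of_iso [IsFiniteCat C] (n : ℕ) {x y : C} (e : x ≅ y) :
    chainCount n x = chainCount n y := by
  have := IsFiniteCat.finite_obj (C := C)
  let := Fintype.ofFinite C
  induction n with
  | zero => simp only [chainCount_zero]
  | succ n ih =>
    rw [chainCount_succ, chainCount_succ, ih]
    simp only [Nat.card_congr (e.homCongr (Iso.refl _))]

end CountChains

/-! ### The class of the simplices of a Grothendieck construction -/

namespace GCat

variable {G : Type u} [Group G] {C : Type u} [Category.{u} C]

theorem burnsideClass_simplices_grothendieck [IsFiniteCat C] [Fintype C] (F : C ⥤ FinGSet G)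
    (n : ℕ) : burnsideClass (simplices (grothendieck F) n) =
      ∑ x, chainCount n x • burnsideClass (F.obj x) := by
  let (x : C) : Fintype (ChainFrom C n x) := Fintype.ofFinite _
  let : Fintype (NDSimplex C n) := inferInstanceAs (Fintype (Σ x, ChainFrom C n x))
  calc burnsideClass (simplices (grothendieck F) n)
      = burnsideClass (FinGSet.sigma fun σ : NDSimplex C n => F.obj σ.1) :=
        burnsideClass_congr (simplicesEquiv F n) (simplicesEquiv_smul F n)
    _ = ∑ σ : NDSimplex C n, burnsideClass (F.obj σ.1) := burnsideClass_sigma _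
    _ = ∑ σ : (Σ x, ChainFrom C n x), burnsideClass (F.obj σ.1) :=
        Fintype.sum_equiv (Equiv.refl _) _ _ fun _ => rfl
    _ = ∑ x, chainCount n x • burnsideClass (F.obj x) := by
        rw [Fintype.sum_sigma]
        refine Finset.sum_congr rfl fun x _ => ?_
        rw [chainCount, Nat.cast_smul_eq_nsmul, Nat.card_eq_fintype_card]
        exact Finset.sum_const (burnsideClass (F.obj x))

end GCat

/-! ### Counting morphisms of the fusion category -/

namespace FusionCat

variable {G : Type u} [Group G]

/-- The conjugate `g H g⁻¹`. -/
abbrev conj (g : G) (H : Subgroup G) : Subgroup G := H.map (MulAut.conj g).toMonoidHom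

theorem conj_mul (g h : G) (H : Subgroup G) : conj (g * h) H = conj g (conj h H) := by
  rw [conj, conj, conj, Subgroup.map_map]
  congr 1
  ext x
  simp

theorem conj_one (H : Subgroup G) : conj 1 H = H := by
  ext x
  simp [conj, Subgroup.mem_map]

theorem mem_conj {g x : G} {H : Subgroup G} : g * x * g⁻¹ ∈ conj g H ↔ x ∈ H := by
  simp [conj, Subgroup.mem_map]

theorem conj_le_iff {g : G} {L K : Subgroup G} : conj g L ≤ K ↔ ∀ x ∈ L, g * x * g⁻¹ ∈ K := by
  simp [conj, SetLike.le_def]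

theorem exists_isConjBy_iff {g : G} {L K : Subgroup G} :
    (∃ φ : L →* K, IsConjBy φ g) ↔ conj g L ≤ K := by
  rw [conj_le_iff]
  constructor
  · rintro ⟨φ, hφ⟩ x hx
    rw [← hφ ⟨x, hx⟩]
    exact (φ _).2
  · intro h
    exact ⟨((MulAut.conj g).toMonoidHom.comp L.subtype).codRestrict K fun x => h x x.2,
      fun x => rfl⟩

theorem IsConjBy.hom_ext {g : G} {L K : Subgroup G} {φ ψ : L →* K} (hφ : IsConjBy φ g)
    (hψ : IsConjBy ψ g) : φ = ψ :=
  MonoidHom.ext fun x => Subtype.ext ((hφ x).trans (hψ x).symm)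

theorem IsConjBy.iff_mem_cent {g h : G} {L K : Subgroup G} {φ : L →* K} (hg : IsConjBy φ g) :
    IsConjBy φ h ↔ g⁻¹ * h ∈ cent L := by
  rw [Subgroup.mem_centralizer_iff]
  constructor
  · intro hh x hx
    have e := (hg ⟨x, hx⟩).symm.trans (hh ⟨x, hx⟩)
    simp only at e
    calc x * (g⁻¹ * h) = g⁻¹ * (g * x * g⁻¹) * h := by group
      _ = g⁻¹ * (h * x * h⁻¹) * h := by rw [e]
      _ = g⁻¹ * h * x := by group
  · intro e x
    rw [hg x]
    calc g * x * g⁻¹ = g * (x * (g⁻¹ * h)) * h⁻¹ := by group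
      _ = g * (g⁻¹ * h * x) * h⁻¹ := by rw [e x x.2]
      _ = h * x * h⁻¹ := by group

variable {S : Set (Subgroup G)}

/-- Each morphism `L → K` of the fusion category is conjugation by exactly `|C_G(L)|` elements. -/
theorem card_hom_mul_card_cent [Finite G] (L K : FusionCat S) :
    Nat.card (L ⟶ K) * Nat.card (cent L.grp) = Nat.card {g : G // conj g L.grp ≤ K.grp} := by
  have e : (L ⟶ K) × cent L.grp ≃ {g : G // conj g L.grp ≤ K.grp} := by
    refine Equiv.ofBijective (fun p => ⟨p.1.2.choose * p.2,
      exists_isConjBy_iff.mp ⟨p.1.1, (IsConjBy.iff_mem_cent p.1.2.choose_spec).mpr (by simp)⟩⟩)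
      ⟨?_, ?_⟩
    · rintro ⟨φ, c⟩ ⟨ψ, d⟩ h
      have h : φ.2.choose * c = ψ.2.choose * d := congrArg Subtype.val h
      have h1 : IsConjBy φ.1 (φ.2.choose * c) :=
        (IsConjBy.iff_mem_cent φ.2.choose_spec).mpr (by simp)
      have h2 : IsConjBy ψ.1 (ψ.2.choose * d) :=
        (IsConjBy.iff_mem_cent ψ.2.choose_spec).mpr (by simp)
      obtain rfl : φ = ψ := Subtype.ext (h1.hom_ext (h ▸ h2))
      exact Prod.ext rfl (Subtype.ext (mul_left_cancel h))
    · rintro ⟨g, hg⟩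
      obtain ⟨φ, hφ⟩ := exists_isConjBy_iff.mpr hg
      let f : L ⟶ K := ⟨φ, g, hφ⟩
      refine ⟨⟨f, ⟨f.2.choose⁻¹ * g, (IsConjBy.iff_mem_cent f.2.choose_spec).mp hφ⟩⟩, ?_⟩
      exact Subtype.ext (mul_inv_cancel_left _ _)
  rw [← Nat.card_prod, Nat.card_congr e]

/-- Conjugation by `g`, as a permutation of the objects of the fusion category. -/
def conjEquiv (hS : ∀ H ∈ S, ∀ g : G, conj g H ∈ S) (g : G) : FusionCat S ≃ FusionCat S where
  toFun H := ⟨conj g H.grp, hS _ H.mem g⟩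
  invFun H := ⟨conj g⁻¹ H.grp, hS _ H.mem g⁻¹⟩
  left_inv H := FusionCat.ext (by simp only [← conj_mul, inv_mul_cancel, conj_one])
  right_inv H := FusionCat.ext (by simp only [← conj_mul, mul_inv_cancel, conj_one])

/-- A subgroup is isomorphic to its conjugates in the fusion category. -/
theorem nonempty_iso_conjEquiv (hS : ∀ H ∈ S, ∀ g : G, conj g H ∈ S) (g : G) (H : FusionCat S) :
    Nonempty (H ≅ conjEquiv hS g H) := by
  obtain ⟨φ, hφ⟩ := exists_isConjBy_iff.mpr (le_refl (conj g H.grp))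
  obtain ⟨ψ, hψ⟩ := exists_isConjBy_iff.mpr
    (show conj g⁻¹ (conj g H.grp) ≤ H.grp by rw [← conj_mul, inv_mul_cancel, conj_one])
  refine ⟨⟨⟨φ, g, hφ⟩, ⟨ψ, g⁻¹, hψ⟩, Subtype.ext ?_, Subtype.ext ?_⟩⟩
  · refine MonoidHom.ext fun x => Subtype.ext ?_
    refine (isConjBy_comp hφ hψ x).trans ?_
    simp [CategoryStruct.id]
  · refine MonoidHom.ext fun x => Subtype.ext ?_
    refine (isConjBy_comp hψ hφ x).trans ?_
    simp [CategoryStruct.id]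

theorem card_cent_conj (g : G) (H : Subgroup G) :
    Nat.card (cent (conj g H)) = Nat.card (cent H) := by
  have h : cent (conj g H) = conj g (cent H) := by
    ext x
    obtain ⟨y, rfl⟩ : ∃ y, x = g * y * g⁻¹ := ⟨g⁻¹ * x * g, by group⟩
    rw [mem_conj, Subgroup.mem_centralizer_iff, Subgroup.mem_centralizer_iff]
    simp only [conj, Subgroup.coe_map, Set.forall_mem_image, SetLike.mem_coe]
    refine forall₂_congr fun h _ => ?_
    simp [← mul_assoc]
    simp [mul_assoc]
  rw [h]
  exact (Nat.card_congr ((MulAut.conj g).subgroupMap (cent H)).toEquiv).symm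

open Classical in
/-- For a conjugation-invariant function `c`, a sum over all morphisms `L → K` of the fusion
category is a sum over the subgroups `H` of `K`. This is double counting of the pairs `(g, L)` with
`g L g⁻¹ ≤ K`, each weighted by `c L / |C_G(L)|`. -/
theorem sum_card_hom_mul [Finite G] [Fintype (FusionCat S)]
    (hS : ∀ H ∈ S, ∀ g : G, conj g H ∈ S)
    (c : FusionCat S → ℚ) (hc : ∀ g H, c (conjEquiv hS g H) = c H) (K : FusionCat S) :
    ∑ L, (Nat.card (L ⟶ K) : ℚ) * c L =
      ∑ H with H.grp ≤ K.grp, ((cent H.grp).index : ℚ) * c H := by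
  let := Fintype.ofFinite G
  have hcent (H : Subgroup G) : (Nat.card (cent H) : ℚ) ≠ 0 := by
    exact_mod_cast Nat.card_pos.ne'
  let d (H : FusionCat S) : ℚ := c H / Nat.card (cent H.grp)
  have hd (g : G) (H : FusionCat S) : d (conjEquiv hS g H) = d H := by
    simp only [d, hc]
    rw [show (conjEquiv hS g H).grp = conj g H.grp from rfl, card_cent_conj]
  calc ∑ L, (Nat.card (L ⟶ K) : ℚ) * c L
      = ∑ L, (Nat.card {g : G // conj g L.grp ≤ K.grp} : ℚ) * d L := by
        refine Finset.sum_congr rfl fun L _ => ?_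
        rw [← card_hom_mul_card_cent]
        push_cast
        rw [mul_assoc, mul_div_cancel₀ _ (hcent L.grp)]
    _ = ∑ L, ∑ g : G, if conj g L.grp ≤ K.grp then d L else 0 := by
        refine Finset.sum_congr rfl fun L _ => ?_
        rw [Nat.card_eq_fintype_card, Fintype.card_subtype, ← Finset.sum_filter,
          Finset.sum_const, nsmul_eq_mul]
    _ = ∑ g : G, ∑ L, if conj g L.grp ≤ K.grp then d L else 0 := Finset.sum_comm
    _ = ∑ _g : G, ∑ H, if H.grp ≤ K.grp then d H else 0 := by
        refine Finset.sum_congr rfl fun g _ => ?_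
        rw [← (conjEquiv hS g).sum_comp fun H => if H.grp ≤ K.grp then d H else 0]
        simp only [hd]
        rfl
    _ = ∑ H with H.grp ≤ K.grp, ((cent H.grp).index : ℚ) * c H := by
        rw [Finset.sum_const, Finset.card_univ, ← Nat.card_eq_fintype_card, ← Finset.sum_filter,
          Finset.smul_sum]
        refine Finset.sum_congr rfl fun H _ => ?_
        rw [← (cent H.grp).index_mul_card, nsmul_eq_mul]
        push_cast
        rw [mul_assoc, mul_div_cancel₀ _ (hcent H.grp)]

end FusionCat

/-! ### Möbius functions and generating functions -/

section Mobius

variable {P : Type u} [PartialOrder P] [Fintype P]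

theorem mobius_self {Q : Type u} [PartialOrder Q] [Finite Q] (a : Q) : mobius a a = 1 := by
  classical
  let := Fintype.ofFinite Q
  let : LocallyFiniteOrder Q := Fintype.toLocallyFiniteOrder
  exact IncidenceAlgebra.mu_self a

open Classical in
/-- The defining relation of the Möbius function on the interval from `-∞` to `b`, with the term
`μ(-∞, -∞) = 1` on the other side. -/
theorem sum_mobius_bot (b : P) :
    ∑ x with x ≤ b, mobius (⊥ : WithBot P) (x : WithBot P) = -1 := by
  let := Fintype.ofFinite (WithBot P)
  let : LocallyFiniteOrder (WithBot P) := Fintype.toLocallyFiniteOrder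
  have h : ∑ x ∈ Finset.Icc (⊥ : WithBot P) b, mobius (⊥ : WithBot P) x = 0 := by
    have := IncidenceAlgebra.sum_Icc_mu_right (𝕜 := ℚ) (⊥ : WithBot P) b
    rw [if_neg WithBot.bot_ne_coe] at this
    convert this
    rw [mobius]
    congr!
  have hs : Finset.Icc (⊥ : WithBot P) b =
      insert ⊥ ((Finset.univ.filter (· ≤ b)).map ⟨WithBot.some, WithBot.coe_injective⟩) := by
    ext x
    induction x using WithBot.recBotCoe <;> simp
  rw [hs, Finset.sum_insert (by simp), Finset.sum_map, mobius_self] at h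
  exact eq_neg_of_add_eq_zero_right h

open Classical in
/-- If `c` satisfies the recurrence of weighted chains in a finite poset, then its generating
functions are fractions whose denominators are products of the factors `1 + (1 - m b) t`, and the
numbers `m b * c_b(-1)` are the solution `-μ(-∞, b)` of the system `∑_{b ≤ a} m b * c_b(-1) = 1`. -/
theorem hasValueAtNegOne_of_recurrence {m : P → ℚ} (hm : ∀ a, m a ≠ 0) {c : ℕ → P → ℚ}
    (h_zero : ∀ a, c 0 a = 1)
    (h_succ : ∀ n a, c (n + 1) a = ∑ b with b ≤ a, m b * c n b - c n a) (a : P) :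
    HasValueAtNegOne (PowerSeries.mk fun n => c n a)
      (-mobius (⊥ : WithBot P) (a : WithBot P) / m a) := by
  induction a using WellFoundedLT.induction with
  | _ a ih =>
  have hle : Finset.univ.filter (· ≤ a) = insert a (Finset.univ.filter (· < a)) := by
    ext x
    simp [le_iff_eq_or_lt]
  -- The recurrence, with the term of index `a` moved to the left, is `r * c_a = 1 + t * ⋯`.
  let r : Polynomial ℚ := 1 + Polynomial.X * Polynomial.C (1 - m a)
  have hr : r.eval (-1) = m a := by simp [r]
  refine HasValueAtNegOne.of_mul (r := r) (hr ▸ hm a) ?_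
  have key : ((r.map (algebraMap ℚ ℚ) : Polynomial ℚ) : PowerSeries ℚ) *
      (PowerSeries.mk fun n => c n a) = ((1 : Polynomial ℚ) : PowerSeries ℚ) +
        ∑ b with b < a, ((Polynomial.X * Polynomial.C (m b) : Polynomial ℚ) : PowerSeries ℚ) *
          PowerSeries.mk fun n => c n b := by
    simp only [r, Algebra.algebraMap_self, Polynomial.map_id, Polynomial.coe_add,
      Polynomial.coe_mul, Polynomial.coe_X, Polynomial.coe_C, Polynomial.coe_one, add_mul,
      one_mul, mul_assoc, ← Finset.mul_sum]
    ext n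
    cases n with
    | zero => simp [h_zero]
    | succ n =>
      simp only [map_add, PowerSeries.coeff_succ_X_mul, map_sum, PowerSeries.coeff_C_mul,
        PowerSeries.coeff_mk, PowerSeries.coeff_one, h_succ]
      rw [hle, Finset.sum_insert (by simp)]
      simp
      ring
  have hval : r.eval (-1) • (-mobius (⊥ : WithBot P) (a : WithBot P) / m a) =
      (1 : Polynomial ℚ).eval (-1) + ∑ b with b < a,
        (Polynomial.X * Polynomial.C (m b) : Polynomial ℚ).eval (-1) *
          (-mobius (⊥ : WithBot P) (b : WithBot P) / m b) := by
    have h := sum_mobius_bot a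
    rw [hle, Finset.sum_insert (by simp)] at h
    have hb (b : P) : (Polynomial.X * Polynomial.C (m b) : Polynomial ℚ).eval (-1) *
        (-mobius (⊥ : WithBot P) (b : WithBot P) / m b) =
          mobius (⊥ : WithBot P) (b : WithBot P) := by
      simp only [Polynomial.eval_mul, Polynomial.eval_X, Polynomial.eval_C]
      field_simp [hm b]
    rw [hr, smul_eq_mul, mul_div_cancel₀ _ (hm a), Finset.sum_congr rfl fun b _ => hb b,
      Polynomial.eval_one]
    linarith
  rw [key, hval]
  exact (HasValueAtNegOne.polynomial 1).add (HasValueAtNegOne.sum _ fun b hb =>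
    (ih b (Finset.mem_filter.mp hb).2).polynomial_mul _)

end Mobius

/-! ### The series of the centralizer decomposition category -/

namespace FusionCat

variable {G : Type u} [Group G] [Finite G] {S : Set (Subgroup G)}

/-- The objects of the fusion category are the members of `S`. -/
def equivSubtype (S : Set (Subgroup G)) : FusionCat S ≃ S where
  toFun H := ⟨H.grp, H.mem⟩
  invFun H := ⟨H, H.2⟩

theorem chainCount_op_conjEquiv (hS : ∀ H ∈ S, ∀ g : G, conj g H ∈ S) (n : ℕ) (g : G)
    (H : FusionCat S) : chainCount n (Opposite.op (conjEquiv hS g H)) =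
      chainCount n (Opposite.op H) :=
  chainCount_eq_of_iso n (nonempty_iso_conjEquiv hS g H).some.op

open Classical in
theorem chainCount_op_succ [Fintype S] (hS : ∀ H ∈ S, ∀ g : G, conj g H ∈ S) (n : ℕ) (K : S) :
    chainCount (n + 1) (Opposite.op ((equivSubtype S).symm K)) =
      ∑ H : S with H ≤ K, ((cent (H : Subgroup G)).index : ℚ) *
        chainCount n (Opposite.op ((equivSubtype S).symm H)) -
      chainCount n (Opposite.op ((equivSubtype S).symm K)) := by
  let := Fintype.ofEquiv S (equivSubtype S).symm
  let := Fintype.ofEquiv (FusionCat S) Opposite.equivToOpposite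
  rw [chainCount_succ, ← Opposite.equivToOpposite.sum_comp]
  have h := sum_card_hom_mul hS (fun H => chainCount n (Opposite.op H))
    (chainCount_op_conjEquiv hS n) ((equivSubtype S).symm K)
  refine congrArg (· - _) (Eq.trans ?_ (h.trans ?_))
  · refine Finset.sum_congr rfl fun L _ => ?_
    rw [Nat.card_congr (opEquiv _ _)]
    rfl
  · rw [Finset.sum_filter, Finset.sum_filter, ← (equivSubtype S).symm.sum_comp]
    rfl

/-- Every chain series `c_H` contributes its value at `-1` times the class of `G/C_G(H)`. -/
theorem hasValueAtNegOne_series [Fintype S] (hS : ∀ H ∈ S, ∀ g : G, conj g H ∈ S) :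
    HasValueAtNegOne (GCat.series (centralizerDecomposition S))
      (∑ H : S, (-mobius (⊥ : WithBot S) (H : WithBot S) / ((cent (H : Subgroup G)).index : ℚ)) •
        burnsideClass (FinGSet.quotient (cent (H : Subgroup G)))) := by
  have hseries : GCat.series (centralizerDecomposition S) = ∑ H : S, PowerSeries.mk fun n =>
      chainCount n (Opposite.op ((equivSubtype S).symm H)) •
        burnsideClass (FinGSet.quotient (cent (H : Subgroup G))) := by
    let := Fintype.ofEquiv S (((equivSubtype S).symm).trans Opposite.equivToOpposite)
    ext n
    simp only [map_sum, GCat.series, PowerSeries.coeff_mk]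
    refine (GCat.burnsideClass_simplices_grothendieck (centFunctor S) n).trans ?_
    rw [← (((equivSubtype S).symm).trans Opposite.equivToOpposite).sum_comp]
    rfl
  rw [hseries]
  refine HasValueAtNegOne.sum _ fun H _ => HasValueAtNegOne.mk_smul ?_ _
  exact hasValueAtNegOne_of_recurrence (m := fun H : S => ((cent (H : Subgroup G)).index : ℚ))
    (fun H => Nat.cast_ne_zero.mpr Subgroup.index_ne_zero_of_finite)
    (c := fun n H => chainCount n (Opposite.op ((equivSubtype S).symm H)))
    (fun H => chainCount_zero _) (chainCount_op_succ hS) H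

end FusionCat

theorem theoremB {G : Type u} [Group G] [Finite G] (S : Set (Subgroup G)) [Fintype S]
    (hS : ∀ H ∈ S, ∀ g : G, H.map (MulAut.conj g).toMonoidHom ∈ S) :
    ∃ h : GCat.HasSeriesLefschetz (centralizerDecomposition S),
      GCat.seriesLefschetz (centralizerDecomposition S) h =
        ∑ H : S,
          (-mobius (⊥ : WithBot S) (H : WithBot S) /
              ((Subgroup.centralizer ((H : Subgroup G) : Set G)).index : ℚ)) •
            burnsideClass (FinGSet.quotient (Subgroup.centralizer ((H : Subgroup G) : Set G))) := by
  have hval := FusionCat.hasValueAtNegOne_series hS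
  have h : GCat.HasSeriesLefschetz (centralizerDecomposition S) := ⟨_, hval⟩
  exact ⟨h, h.choose_spec.unique hval⟩
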